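/- Let $q$ be a prime power, and let $n_r,s,k,\tau\ge 0$ be integers with $k\ge 1$ and $\tau+k\le n_r$. Let $a^{[i]}=a^{q^i}$, and let $(x_i,r_i^{(1)},\dots,r_i^{(s)})\in\mathbb F_{q^m}^{s+1}$, $0\le i<n_r$, be interpolation points (for instance a basis of a received subspace). Consider $(s+1)$-variate linearized polynomials $Q=Q_0(x)+Q_1(y_1)+\dots+Q_s(y_s)$, $Q_j(y)=\sum_i q_{j,i}\,y^{[i]}$ with $q_{j,i}\in\mathbb F_{q^m}$; write $y_0=x$. The $(1,k-1,\dots,k-1)$-weighted degree is $\deg_w Q=\max\{\deg_q Q_0,\ k-1+\deg_q Q_1,\dots,k-1+\deg_q Q_s\}$. Monomials are ordered by $x^{[\ell+k-1]}\prec y_1^{[\ell]}\prec\dots\prec y_s^{[\ell]}\prec x^{[\ell+k]}$, and the leading term is the $\prec$-largest monomial. Algorithm $\mathrm{InterpolateBasis}$: start with $g_{0,j}=y_j$ for $0\le j\le s$. For $i=0,\dots,n_r-1$ put $P_i=(x_i,r_i^{(1)},\dots,r_i^{(s)})$, $\Delta_j=g_{i,j}(P_i)$ and $J=\{j:\Delta_j\ne0\}$.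 For $j\notin J$ put $g_{i+1,j}=g_{i,j}$. If $J\neq\emptyset$, let $j^*\in J$ be the index for which $g_{i,j^*}$ has the $\prec$-smallest leading term; put $g_{i+1,j}=\Delta_{j^*}g_{i,j}-\Delta_j g_{i,j^*}$ for $j\in J\setminus\{j^*\}$ and $g_{i+1,j^*}=\Delta_{j^*}\,(x^{[1]}\otimes g_{i,j^*})-(x^{[1]}\otimes g_{i,j^*})(P_i)\,g_{i,j^*}$, where $\otimes$ is composition. The output is $g_{n_r,1},\dots,g_{n_r,s}$. Let $\mathbf R$ be the $n_r\times\big((n_r-\tau)+s(n_r-\tau-k+1)\big)$ matrix over $\mathbb F_{q^m}$ whose $i$-th row is $\big(x_i^{[0]},\dots,x_i^{[n_r-\tau-1]}\,\big|\,r_i^{(1)[0]},\dots,r_i^{(1)[n_r-\tau-k]}\,\big|\cdots\big|\,r_i^{(s)[0]},\dots,r_i^{(s)[n_r-\tau-k]}\big)$, let $d_I=\dim\ker\mathbf R$, and let $\mathbf q^{(1)},\dots,\mathbf q^{(d_I)}$ be a basis of $\ker\mathbf R$ with entries written as $\mathbf q^{(h)}=(q^{(h)}_{0,0},\dots,q^{(h)}_{0,n_r-\tau-1}\,|\cdots|\,q^{(h)}_{s,0},\dots,q^{(h)}_{s,n_r-\tau-k})$.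 Let $\mathbf Q_{n_r-\tau-k}=\big(q^{(h)}_{j,n_r-\tau-k}\big)_{1\le h\le d_I,\;1\le j\le s}$. If $\operatorname{rk}\mathbf Q_{n_r-\tau-k}=s$ (rank over $\mathbb F_{q^m}$), then $g_{n_r,1},\dots,g_{n_r,s}$ are linearly independent over $\mathbb F_{q^m}$ and each of them satisfies $\deg_w g_{n_r,j}<n_r-\tau$. Together they solve the extended interpolation problem: they are (at least) $s$ linearly independent nonzero polynomials $Q$, each with $Q(x_i,r_i^{(1)},\dots,r_i^{(s)})=0$ for all $0\le i<n_r$, $\deg_q Q_0<n_r-\tau$, and $\deg_q Q_j<n_r-\tau-(k-1)$ for all $1\le j\le s$. -/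

import Mathlib

noncomputable section

namespace LinInterp

/-- A linearized polynomial `p(x) = ∑ i, p i * x ^ (q ^ i)` (the zero polynomial included), stored
by its coefficients: `p i` is the coefficient of `x^[i] = x ^ (q ^ i)`. -/
abbrev LinPoly (F : Type*) [Field F] : Type _ := ℕ →₀ F

/-- The `q`-degree, equal to `⊥` for the zero polynomial. -/
def qDegree {F : Type*} [Field F] (p : LinPoly F) : WithBot ℕ := p.support.max

/-- The value `p(a) = ∑ i, p i * a ^ (q ^ i)`. -/
def LinPoly.eval {F : Type*} [Field F] (q : ℕ) (p : LinPoly F) (a : F) : F :=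
  p.sum fun i c => c * a ^ (q ^ i)

/-- The composition `p₁ ⊗ p₂ = p₁(p₂(x))`; on monomials,
`a x^[d] ⊗ c x^[i] = a c^[d] x^[i + d]`. -/
def LinPoly.comp {F : Type*} [Field F] (q : ℕ) (p₁ p₂ : LinPoly F) : LinPoly F :=
  p₁.sum fun d a => p₂.sum fun i c => Finsupp.single (i + d) (a * c ^ (q ^ d))

/-- An `(s+1)`-variate linearized polynomial `Q = Q₀(y₀) + Q₁(y₁) + ⋯ + Q_s(y_s)`, where
`y₀ = x`; equivalently an element `∑ j, Q_j ⊗ y_j` of the free left module with basis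
`y₀, …, y_s` over the ring of linearized polynomials. -/
abbrev MvLinPoly (F : Type*) [Field F] (s : ℕ) : Type _ := Fin (s + 1) → LinPoly F

/-- The value `Q₀(a₀) + Q₁(a₁) + ⋯ + Q_s(a_s)`. -/
def MvLinPoly.eval {F : Type*} [Field F] {s : ℕ} (q : ℕ) (Q : MvLinPoly F s)
    (a : Fin (s + 1) → F) : F :=
  ∑ j, LinPoly.eval q (Q j) (a j)

/-- The left action `p ⊗ Q = ∑ j, (p ⊗ Q_j) ⊗ y_j`. -/
def MvLinPoly.comp {F : Type*} [Field F] {s : ℕ} (q : ℕ) (p : LinPoly F) (Q : MvLinPoly F s) :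
    MvLinPoly F s :=
  fun j => LinPoly.comp q p (Q j)

/-- The weights `(1, k-1, …, k-1)`: nothing is added to the `q`-degree in `y₀ = x`, and `k - 1` is
added to the `q`-degrees in `y₁, …, y_s`. -/
def weight {s : ℕ} (k : ℕ) (j : Fin (s + 1)) : ℕ := if j = 0 then 0 else k - 1

/-- The `(1, k-1, …, k-1)`-weighted degree
`max (deg_q Q₀, k - 1 + deg_q Q₁, …, k - 1 + deg_q Q_s)`, equal to `⊥` for `Q = 0`. -/
def weightedDegree {F : Type*} [Field F] {s : ℕ} (k : ℕ) (Q : MvLinPoly F s) : WithBot ℕ :=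
  Finset.univ.sup fun j => (weight k j : WithBot ℕ) + qDegree (Q j)

/-- The position of the monomial `y_j^[i]` in the total order `≺`
(`x^[ℓ+k-1] ≺ y₁^[ℓ] ≺ ⋯ ≺ y_s^[ℓ] ≺ x^[ℓ+k]`): monomials are compared by weighted degree
first, then by the index of the variable. -/
def monomialRank {s : ℕ} (k : ℕ) (j : Fin (s + 1)) (i : ℕ) : ℕ ×ₗ Fin (s + 1) :=
  toLex (weight k j + i, j)

/-- The position of the leading term of `Q`, i.e. of its largest monomial under `≺`
(`⊥` for `Q = 0`). -/
def leadingRank {F : Type*} [Field F] {s : ℕ} (k : ℕ) (Q : MvLinPoly F s) :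
    WithBot (ℕ ×ₗ Fin (s + 1)) :=
  Finset.univ.sup fun j => (Q j).support.sup fun i =>
    ((monomialRank k j i : ℕ ×ₗ Fin (s + 1)) : WithBot (ℕ ×ₗ Fin (s + 1)))

/-! The interpolation problem. -/

/-- The interpolation point `(x_i, r_i^(1), …, r_i^(s))`. -/
def point {F : Type*} {n s : ℕ} (x : Fin n → F) (r : Fin s → Fin n → F) (i : Fin n) :
    Fin (s + 1) → F :=
  Fin.cons (x i) fun j => r j i

/-- `Q` satisfies the interpolation constraints for the given data and is nonzero. -/
structure IsInterpolationSolution {F : Type*} [Field F] {n s : ℕ} (q τ k : ℕ)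
    (x : Fin n → F) (r : Fin s → Fin n → F) (Q : MvLinPoly F s) : Prop where
  ne_zero : Q ≠ 0
  vanish : ∀ i, MvLinPoly.eval q Q (point x r i) = 0
  degree_zero : qDegree (Q 0) < ((n - τ : ℕ) : WithBot ℕ)
  degree_succ : ∀ j : Fin s, qDegree (Q j.succ) < ((n - τ - (k - 1) : ℕ) : WithBot ℕ)

/-- The polynomials `Q^(1), …, Q^(d)` solve the extended interpolation problem: there are at least
`s` of them, they are linearly independent, and each of them is a nonzero polynomial that satisfies
the interpolation constraints. -/
structure SolvesExtendedInterpolation {F : Type*} [Field F] {n s d : ℕ} (q τ k : ℕ)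
    (x : Fin n → F) (r : Fin s → Fin n → F) (Q : Fin d → MvLinPoly F s) : Prop where
  le_card : s ≤ d
  linearIndependent : LinearIndependent F Q
  solution : ∀ h, IsInterpolationSolution q τ k x r (Q h)

/-- The columns of the interpolation matrix, equivalently the unknown coefficients: `Sum.inl i`
stands for `q_{0,i}` with `0 ≤ i ≤ n - τ - 1`, and `Sum.inr (j, i)` for the coefficient `q_{j,i}`
of `y_j^[i]` with `0 ≤ i ≤ n - τ - k` (here `j : Fin s` is counted from zero). -/
abbrev CoeffIndex (n s τ k : ℕ) : Type := Fin (n - τ) ⊕ (Fin s × Fin (n - τ - k + 1))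

/-- The interpolation matrix `R`, made of transposed `q`-Vandermonde matrices. -/
def interpolationMatrix {F : Type*} [Field F] {n s : ℕ} (q τ k : ℕ)
    (x : Fin n → F) (r : Fin s → Fin n → F) : Matrix (Fin n) (CoeffIndex n s τ k) F :=
  Matrix.of fun i => Sum.elim (fun e : Fin (n - τ) => x i ^ (q ^ (e : ℕ)))
    (fun c : Fin s × Fin (n - τ - k + 1) => r c.1 i ^ (q ^ (c.2 : ℕ)))

/-- The solution space `ker R` of the interpolation system. -/
def solutionSpace {F : Type*} [Field F] {n s : ℕ} (q τ k : ℕ)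
    (x : Fin n → F) (r : Fin s → Fin n → F) : Submodule F (CoeffIndex n s τ k → F) :=
  LinearMap.ker (interpolationMatrix q τ k x r).mulVecLin

/-- The matrix `Q_{n-τ-k}`: row `h` holds the coefficients
`q_{1,n-τ-k}^(h), …, q_{s,n-τ-k}^(h)` of the `h`-th coefficient vector. -/
def leadingCoeffMatrix {F : Type*} {n s τ k d : ℕ} (v : Fin d → CoeffIndex n s τ k → F) :
    Matrix (Fin d) (Fin s) F :=
  Matrix.of fun h j => v h (Sum.inr (j, Fin.last (n - τ - k)))

/-! The interpolation algorithm. -/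

/-- The index set `J` of the polynomials that do not vanish at the point `a`. -/
def discrepancySet {F : Type*} [Field F] {s : ℕ} (q : ℕ) (a : Fin (s + 1) → F)
    (g : Fin (s + 1) → MvLinPoly F s) : Set (Fin (s + 1)) :=
  {j | MvLinPoly.eval q (g j) a ≠ 0}

open Classical in
/-- One step of the algorithm, at the point `a`. Let `Δ_j = g_j(a)` and `J = {j | Δ_j ≠ 0}`. If `J`
is empty, nothing changes. Otherwise let `j*` be the index in `J` whose polynomial has the smallest
leading term. Then
* `g_{j*}` becomes `Δ_{j*} (x^[1] ⊗ g_{j*}) - (x^[1] ⊗ g_{j*})(a) g_{j*}`,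
* `g_j` becomes `Δ_{j*} g_j - Δ_j g_{j*}` for the other `j` in `J`,
* `g_j` is kept for `j` outside `J`. -/
def interpolationStep {F : Type*} [Field F] {s : ℕ} (q k : ℕ) (a : Fin (s + 1) → F)
    (g : Fin (s + 1) → MvLinPoly F s) : Fin (s + 1) → MvLinPoly F s :=
  if hJ : (discrepancySet q a g).Nonempty then
    let jmin := Function.argminOn (fun j => leadingRank k (g j)) (discrepancySet q a g) hJ
    fun j =>
      if j = jmin then
        MvLinPoly.eval q (g jmin) a • MvLinPoly.comp q (Finsupp.single 1 1) (g jmin)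
          - MvLinPoly.eval q (MvLinPoly.comp q (Finsupp.single 1 1) (g jmin)) a • g jmin
      else if j ∈ discrepancySet q a g then
        MvLinPoly.eval q (g jmin) a • g j - MvLinPoly.eval q (g j) a • g jmin
      else g j
  else g

/-- The polynomials `g_{i,0}, …, g_{i,s}` after `i` steps, starting with `g_{0,j} = y_j` and
processing one point per step. -/
def interpolationRun {F : Type*} [Field F] {n s : ℕ} (q k : ℕ)
    (x : Fin n → F) (r : Fin s → Fin n → F) : ℕ → Fin (s + 1) → MvLinPoly F s
  | 0 => fun j => Pi.single j (Finsupp.single 0 1)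
  | i + 1 =>
    if h : i < n then
      interpolationStep q k (point x r ⟨i, h⟩) (interpolationRun q k x r i)
    else interpolationRun q k x r i

/-- The output `g_{n,1}, …, g_{n,s}` of the algorithm. -/
def interpolateBasis {F : Type*} [Field F] {n s : ℕ} (q k : ℕ)
    (x : Fin n → F) (r : Fin s → Fin n → F) : Fin s → MvLinPoly F s :=
  fun j => interpolationRun q k x r n j.succ

end LinInterp

end

/-! For each number `m` of processed points the run maintains a minimal Gröbner basis of the left
module of polynomials vanishing at those points: `g j` is led by a power of `y_j`, with the least
exponent possible in the module (`IsMinimalFamily`, preserved by `IsMinimalFamily.step`). The crux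
is that the pivot's exponent must really grow. An element of the new module with the old leading
monomial, cancelled against the pivot, reduces to zero through family members below the pivot. These
vanish at the new point by the choice of pivot, whereas the pivot does not
(`IsMinimalFamily.eval_eq_zero`).

The rank hypothesis supplies, for each `j ≥ 1`, a kernel vector whose polynomial is led by
`y_j^[n-τ-k]` (`exists_solution_of_rank_eq`, `isLeading_ofCoeffs`). By minimality the output `g j`
has at most this leading monomial, of weighted degree `n-τ-1`. Independence holds because the
leading variables are distinct. -/

namespace LinInterp

variable {F : Type*} [Field F] {s : ℕ}

/-! ### Linearity of evaluation and composition with `x^[1]` -/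

section Evaluation

lemma LinPoly.eval_add (q : ℕ) (p p' : LinPoly F) (a : F) :
    LinPoly.eval q (p + p') a = LinPoly.eval q p a + LinPoly.eval q p' a :=
  Finsupp.sum_add_index' (fun _ => zero_mul _) (fun _ _ _ => add_mul _ _ _)

lemma LinPoly.eval_smul (q : ℕ) (c : F) (p : LinPoly F) (a : F) :
    LinPoly.eval q (c • p) a = c * LinPoly.eval q p a := by
  unfold LinPoly.eval
  rw [Finsupp.sum_smul_index (fun _ => zero_mul _), Finsupp.mul_sum]
  simp only [mul_assoc]

/-- Evaluation at a point, as a linear functional. -/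
def MvLinPoly.evalLinear (q : ℕ) (a : Fin (s + 1) → F) : MvLinPoly F s →ₗ[F] F where
  toFun Q := MvLinPoly.eval q Q a
  map_add' Q Q' := by
    simp [MvLinPoly.eval, LinPoly.eval_add, Finset.sum_add_distrib]
  map_smul' c Q := by
    simp [MvLinPoly.eval, LinPoly.eval_smul, Finset.mul_sum]

lemma MvLinPoly.eval_sub_smul (q : ℕ) (a : Fin (s + 1) → F) (c c' : F) (Q Q' : MvLinPoly F s) :
    MvLinPoly.eval q (c • Q - c' • Q') a =
      c * MvLinPoly.eval q Q a - c' * MvLinPoly.eval q Q' a := by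
  change MvLinPoly.evalLinear q a (c • Q - c' • Q') = _
  rw [map_sub, map_smul, map_smul]
  rfl

/-- Composition with `x^[1]` from the left. -/
noncomputable abbrev MvLinPoly.shift (q : ℕ) (Q : MvLinPoly F s) : MvLinPoly F s :=
  MvLinPoly.comp q (Finsupp.single 1 1) Q

lemma LinPoly.comp_single_one {q : ℕ} (p : LinPoly F) :
    LinPoly.comp q (Finsupp.single 1 1) p = p.sum fun i c => Finsupp.single (i + 1) (c ^ q) := by
  unfold LinPoly.comp
  rw [Finsupp.sum_single_index] <;> simp

/-- The `q`-power map is additive, so it passes through the sum defining the value. -/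
lemma LinPoly.eval_comp_single_one {q : ℕ} (φ : F →+* F) (hφ : ∀ a, φ a = a ^ q)
    (p : LinPoly F) (a : F) :
    LinPoly.eval q (LinPoly.comp q (Finsupp.single 1 1) p) a = LinPoly.eval q p a ^ q := by
  rw [LinPoly.comp_single_one, ← hφ]
  unfold LinPoly.eval
  rw [Finsupp.sum_sum_index (fun _ => zero_mul _) (fun _ _ _ => add_mul _ _ _), Finsupp.sum,
    Finsupp.sum, map_sum]
  refine Finset.sum_congr rfl fun i _ => ?_
  rw [Finsupp.sum_single_index (zero_mul _), hφ, mul_pow, ← pow_mul, ← pow_succ]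

lemma MvLinPoly.eval_shift {q : ℕ} (φ : F →+* F) (hφ : ∀ a, φ a = a ^ q)
    (Q : MvLinPoly F s) (a : Fin (s + 1) → F) :
    MvLinPoly.eval q (MvLinPoly.shift q Q) a = MvLinPoly.eval q Q a ^ q := by
  rw [← hφ]
  unfold MvLinPoly.eval
  rw [map_sum]
  refine Finset.sum_congr rfl fun j _ => ?_
  rw [hφ]
  exact LinPoly.eval_comp_single_one φ hφ _ _

lemma MvLinPoly.shift_apply_zero (q : ℕ) (Q : MvLinPoly F s) (j : Fin (s + 1)) :
    MvLinPoly.shift q Q j 0 = 0 := by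
  simp [MvLinPoly.shift, MvLinPoly.comp, LinPoly.comp_single_one, Finsupp.sum,
    Finsupp.finsetSum_apply]

lemma MvLinPoly.shift_apply_succ {q : ℕ} (hq : q ≠ 0) (Q : MvLinPoly F s) (j : Fin (s + 1))
    (i : ℕ) : MvLinPoly.shift q Q j (i + 1) = Q j i ^ q := by
  simp [MvLinPoly.shift, MvLinPoly.comp, LinPoly.comp_single_one, Finsupp.sum,
    Finsupp.finsetSum_apply, Finsupp.single_apply]
  intro h
  rw [h, zero_pow hq]

end Evaluation

/-! ### Leading monomials and their behaviour under the operations of the algorithm -/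

section LeadingTerm

lemma monomialRank_injective {k : ℕ} {j j' : Fin (s + 1)} {i i' : ℕ}
    (h : monomialRank k j i = monomialRank k j' i') : j = j' ∧ i = i' := by
  have h' := toLex.injective h
  rw [Prod.mk.injEq] at h'
  obtain ⟨h1, rfl⟩ := h'
  exact ⟨rfl, by omega⟩

lemma monomialRank_le_iff {k : ℕ} {j j' : Fin (s + 1)} {i i' : ℕ} :
    monomialRank k j i ≤ monomialRank k j' i' ↔
      weight k j + i < weight k j' + i' ∨ weight k j + i = weight k j' + i' ∧ j ≤ j' :=
  Prod.Lex.toLex_le_toLex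

lemma monomialRank_lt_iff {k : ℕ} {j j' : Fin (s + 1)} {i i' : ℕ} :
    monomialRank k j i < monomialRank k j' i' ↔
      weight k j + i < weight k j' + i' ∨ weight k j + i = weight k j' + i' ∧ j < j' :=
  Prod.Lex.toLex_lt_toLex

/-- `y_j^[i]` is the leading monomial of `Q`. -/
structure IsLeading (k : ℕ) (Q : MvLinPoly F s) (j : Fin (s + 1)) (i : ℕ) : Prop where
  ne_zero : Q j i ≠ 0
  le : ∀ j' i', Q j' i' ≠ 0 → monomialRank k j' i' ≤ monomialRank k j i

lemma IsLeading.leadingRank_eq {k : ℕ} {Q : MvLinPoly F s} {j : Fin (s + 1)} {i : ℕ}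
    (h : IsLeading k Q j i) :
    leadingRank k Q = ((monomialRank k j i : ℕ ×ₗ Fin (s + 1)) : WithBot _) := by
  apply le_antisymm
  · refine Finset.sup_le fun j' _ => Finset.sup_le fun i' hi' => ?_
    exact WithBot.coe_le_coe.2 (h.le j' i' (Finsupp.mem_support_iff.1 hi'))
  · refine Finset.le_sup_of_le (Finset.mem_univ j) ?_
    exact Finset.le_sup_of_le (Finsupp.mem_support_iff.2 h.ne_zero) le_rfl

lemma exists_isLeading (k : ℕ) {Q : MvLinPoly F s} (hQ : Q ≠ 0) : ∃ j i, IsLeading k Q j i := by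
  classical
  obtain ⟨j₀, hj₀⟩ := Function.ne_iff.1 hQ
  obtain ⟨i₀, hi₀⟩ := Finsupp.ne_iff.1 hj₀
  have hne : (Finset.univ.sigma fun j => (Q j).support).Nonempty :=
    ⟨⟨j₀, i₀⟩, by simpa using hi₀⟩
  obtain ⟨⟨j, i⟩, hmem, hmax⟩ := Finset.exists_max_image _
    (fun m : (_ : Fin (s + 1)) × ℕ => monomialRank k m.1 m.2) hne
  exact ⟨j, i, by simpa using hmem, fun j' i' h => hmax ⟨j', i'⟩ (by simpa using h)⟩

lemma IsLeading.sub_smul {k : ℕ} {Q Q' : MvLinPoly F s} {j j' : Fin (s + 1)} {i i' : ℕ}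
    (h : IsLeading k Q j i) (h' : IsLeading k Q' j' i')
    (hlt : monomialRank k j' i' < monomialRank k j i) {c : F} (hc : c ≠ 0) (c' : F) :
    IsLeading k (c • Q - c' • Q') j i where
  ne_zero := by
    have : Q' j i = 0 := by
      by_contra hne
      exact absurd (h'.le _ _ hne) (not_le.2 hlt)
    simp [this, hc, h.ne_zero]
  le := by
    intro a b hab
    by_cases hQ : Q a b = 0
    · by_cases hQ' : Q' a b = 0
      · simp [hQ, hQ'] at hab
      · exact (h'.le _ _ hQ').trans hlt.le
    · exact h.le _ _ hQ

/-- Raising every exponent by one preserves all comparisons under `≺`. -/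
lemma IsLeading.shift {k q : ℕ} (hq : q ≠ 0) {Q : MvLinPoly F s} {j : Fin (s + 1)} {i : ℕ}
    (h : IsLeading k Q j i) : IsLeading k (MvLinPoly.shift q Q) j (i + 1) where
  ne_zero := by
    rw [MvLinPoly.shift_apply_succ hq]
    exact pow_ne_zero _ h.ne_zero
  le := by
    rintro j' (_ | i') hne
    · exact absurd (MvLinPoly.shift_apply_zero q Q j') hne
    · rw [MvLinPoly.shift_apply_succ hq] at hne
      have := h.le _ _ (ne_zero_pow hq hne)
      rw [monomialRank_le_iff] at this ⊢
      omega

lemma IsLeading.shift_iterate {k q : ℕ} (hq : q ≠ 0) {Q : MvLinPoly F s} {j : Fin (s + 1)} {i : ℕ}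
    (h : IsLeading k Q j i) (l : ℕ) : IsLeading k ((MvLinPoly.shift q)^[l] Q) j (i + l) := by
  induction l with
  | zero => exact h
  | succ l ih =>
    rw [Function.iterate_succ_apply']
    exact ih.shift hq

/-- Cancelling the leading terms of two polynomials with the same leading monomial. -/
lemma IsLeading.lt_of_cancel {k : ℕ} {Q Q' : MvLinPoly F s} {j : Fin (s + 1)} {i : ℕ}
    (h : IsLeading k Q j i) (h' : IsLeading k Q' j i) {a : Fin (s + 1)} {b : ℕ}
    (hab : (Q' j i • Q - Q j i • Q') a b ≠ 0) : monomialRank k a b < monomialRank k j i := by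
  refine lt_of_le_of_ne ?_ fun heq => ?_
  · by_cases hQ : Q a b = 0
    · by_cases hQ' : Q' a b = 0
      · simp [hQ, hQ'] at hab
      · exact h'.le _ _ hQ'
    · exact h.le _ _ hQ
  · obtain ⟨rfl, rfl⟩ := monomialRank_injective heq
    exact hab (by simp [mul_comm])

/-- In a vanishing combination, the largest leading monomial with nonzero coefficient cannot be
cancelled, since the other leading monomials lie in other variables. -/
lemma linearIndependent_of_isLeading {k : ℕ} {g : Fin (s + 1) → MvLinPoly F s}
    (hg : ∀ j, ∃ i, IsLeading k (g j) j i) : LinearIndependent F g := by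
  classical
  choose e he using hg
  rw [Fintype.linearIndependent_iff]
  intro c hc
  by_contra! hne
  obtain ⟨j₀, hj₀⟩ := hne
  obtain ⟨j, hj, hmax⟩ := Finset.exists_max_image (Finset.univ.filter fun j => c j ≠ 0)
    (fun j => monomialRank k j (e j)) ⟨j₀, by simpa using hj₀⟩
  have hcj : c j ≠ 0 := by simpa using hj
  have hcoef := DFunLike.congr_fun (congrFun hc j) (e j)
  simp only [Finset.sum_apply, Pi.smul_apply, Finsupp.finsetSum_apply, Finsupp.smul_apply,
    Pi.zero_apply, Finsupp.zero_apply, smul_eq_mul] at hcoef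
  rw [Finset.sum_eq_single j] at hcoef
  · exact (mul_ne_zero hcj (he j).ne_zero) hcoef
  · intro j' _ hne
    by_contra hmul
    have hle := (he j').le _ _ (right_ne_zero_of_mul hmul)
    have hle' := hmax j' (by simpa using left_ne_zero_of_mul hmul)
    exact hne (monomialRank_injective (le_antisymm hle' hle)).1
  · simp

end LeadingTerm

/-! ### Degree bounds in terms of coefficients -/

section Degree

lemma qDegree_lt_iff {p : LinPoly F} {N : ℕ} :
    qDegree p < (N : WithBot ℕ) ↔ ∀ i, p i ≠ 0 → i < N := by
  unfold qDegree
  rw [Finset.max_eq_sup_coe, Finset.sup_lt_iff (a := (N : WithBot ℕ)) (WithBot.bot_lt_coe N)]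
  simp only [Finsupp.mem_support_iff]
  exact forall₂_congr fun i _ => WithBot.coe_lt_coe

lemma weightedDegree_lt_iff {k : ℕ} {Q : MvLinPoly F s} {N : ℕ} :
    weightedDegree k Q < (N : WithBot ℕ) ↔ ∀ j i, Q j i ≠ 0 → weight k j + i < N := by
  unfold weightedDegree
  rw [Finset.sup_lt_iff (a := (N : WithBot ℕ)) (WithBot.bot_lt_coe N)]
  simp only [Finset.mem_univ, true_imp_iff]
  refine forall_congr' fun j => ?_
  rcases h : qDegree (Q j) with _ | d
  · have h0 : Q j = 0 := Finsupp.support_eq_empty.1 (Finset.max_eq_bot.1 h)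
    simp only [h0, Finsupp.zero_apply, ne_eq, not_true_eq_false, false_imp_iff, implies_true,
      iff_true]
    exact (WithBot.add_bot _).trans_lt (WithBot.bot_lt_coe N)
  · have hcast : (weight k j : WithBot ℕ) + ((d : ℕ) : WithBot ℕ) = ((weight k j + d : ℕ)) := by
      push_cast; rfl
    refine Iff.trans (b := weight k j + d < N) ?_ ⟨fun hlt i hi => ?_, fun hall => ?_⟩
    · exact (iff_of_eq (congrArg (· < (N : WithBot ℕ)) hcast)).trans WithBot.coe_lt_coe
    · have := Finset.le_max_of_eq (Finsupp.mem_support_iff.2 hi) h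
      omega
    · exact hall d (Finsupp.mem_support_iff.1 (Finset.mem_of_max h))

end Degree

/-! ### The Gröbner basis invariant of the algorithm -/

section Algorithm

/-- Each `g j` lies in `V`, has its leading monomial in the variable `y_j`, and this monomial is the
smallest one among the elements of `V` led by `y_j`. -/
structure IsMinimalFamily (k : ℕ) (V : Set (MvLinPoly F s)) (g : Fin (s + 1) → MvLinPoly F s)
    (e : Fin (s + 1) → ℕ) : Prop where
  mem : ∀ j, g j ∈ V
  isLeading : ∀ j, IsLeading k (g j) j (e j)
  minimal : ∀ Q ∈ V, ∀ j i, IsLeading k Q j i → e j ≤ i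

/-- The polynomials that vanish at the first `m` points. -/
def vanishing {n : ℕ} (q : ℕ) (P : Fin n → Fin (s + 1) → F) (m : ℕ) : Set (MvLinPoly F s) :=
  {Q | ∀ l : Fin n, (l : ℕ) < m → MvLinPoly.eval q Q (P l) = 0}

variable {n q : ℕ} {P : Fin n → Fin (s + 1) → F}

lemma sub_smul_mem_vanishing {m : ℕ} {Q Q' : MvLinPoly F s} (hQ : Q ∈ vanishing q P m)
    (hQ' : Q' ∈ vanishing q P m) (c c' : F) : c • Q - c' • Q' ∈ vanishing q P m := fun l hl => by
  rw [MvLinPoly.eval_sub_smul, hQ l hl, hQ' l hl, mul_zero, mul_zero, sub_zero]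

lemma eval_shift_eq_zero (hq : q ≠ 0) (φ : F →+* F) (hφ : ∀ a, φ a = a ^ q) {Q : MvLinPoly F s}
    {a : Fin (s + 1) → F} (h : MvLinPoly.eval q Q a = 0) :
    MvLinPoly.eval q (MvLinPoly.shift q Q) a = 0 := by
  rw [MvLinPoly.eval_shift φ hφ, h, zero_pow hq]

lemma eval_shift_iterate_eq_zero (hq : q ≠ 0) (φ : F →+* F) (hφ : ∀ a, φ a = a ^ q)
    {Q : MvLinPoly F s} {a : Fin (s + 1) → F} (h : MvLinPoly.eval q Q a = 0) (l : ℕ) :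
    MvLinPoly.eval q ((MvLinPoly.shift q)^[l] Q) a = 0 := by
  induction l with
  | zero => exact h
  | succ l ih =>
    rw [Function.iterate_succ_apply']
    exact eval_shift_eq_zero hq φ hφ ih

/-- An element of the vanishing module that reduces to zero by members of a minimal family that
vanish at `a` vanishes at `a` as well. -/
lemma IsMinimalFamily.eval_eq_zero {k m : ℕ} (hq : q ≠ 0) (φ : F →+* F) (hφ : ∀ a, φ a = a ^ q)
    {g : Fin (s + 1) → MvLinPoly F s} {e : Fin (s + 1) → ℕ}
    (hg : IsMinimalFamily k (vanishing q P m) g e) (a : Fin (s + 1) → F) (ρ : ℕ ×ₗ Fin (s + 1))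
    (ha : ∀ j, monomialRank k j (e j) < ρ → MvLinPoly.eval q (g j) a = 0)
    (Q : MvLinPoly F s) (hQ : Q ∈ vanishing q P m)
    (hlt : ∀ j i, Q j i ≠ 0 → monomialRank k j i < ρ) : MvLinPoly.eval q Q a = 0 := by
  induction ρ using WellFoundedLT.induction generalizing Q with
  | ind ρ ih =>
    by_cases h0 : Q = 0
    · rw [h0]
      exact map_zero (MvLinPoly.evalLinear q a)
    obtain ⟨j, i, hji⟩ := exists_isLeading k h0
    have hρ := hlt j i hji.ne_zero
    -- Minimality of `e j` makes the leading monomial of `Q` a shift of that of `g j`, so a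
    -- reduction step is always available.
    obtain ⟨l, rfl⟩ := Nat.exists_eq_add_of_le (hg.minimal Q hQ j i hji)
    have hlead := (hg.isLeading j).shift_iterate hq l
    set G := (MvLinPoly.shift q)^[l] (g j)
    have hGmem : G ∈ vanishing q P m := fun t ht =>
      eval_shift_iterate_eq_zero hq φ hφ (hg.mem j t ht) l
    have hGa : MvLinPoly.eval q G a = 0 := by
      refine eval_shift_iterate_eq_zero hq φ hφ (ha j (lt_of_le_of_lt ?_ hρ)) l
      rw [monomialRank_le_iff]
      rcases l with _ | l
      · exact .inr ⟨rfl, le_rfl⟩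
      · left; omega
    -- The cross-multiplied difference has only monomials below the leading one of `Q`, which serves
    -- as the new bound.
    have hred := ih _ hρ (fun j' hj' => ha j' (hj'.trans hρ)) (G j (e j + l) • Q - Q j (e j + l) • G)
      (sub_smul_mem_vanishing hQ hGmem _ _) (fun a' b' h => hji.lt_of_cancel hlead h)
    rw [MvLinPoly.eval_sub_smul, hGa, mul_zero, sub_zero] at hred
    exact (mul_eq_zero.1 hred).resolve_left hlead.ne_zero

lemma vanishing_succ {m : ℕ} (hm : m < n) {Q : MvLinPoly F s} :
    Q ∈ vanishing q P (m + 1) ↔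
      Q ∈ vanishing q P m ∧ MvLinPoly.eval q Q (P ⟨m, hm⟩) = 0 := by
  refine ⟨fun h => ⟨fun l hl => h l (by omega), h ⟨m, hm⟩ (Nat.lt_succ_self m)⟩, ?_⟩
  rintro ⟨h, h'⟩ l hl
  rcases Nat.lt_succ_iff_lt_or_eq.1 hl with hl | rfl
  · exact h l hl
  · exact h'

open Classical in
lemma interpolationStep_of_nonempty (k : ℕ) {a : Fin (s + 1) → F}
    {g : Fin (s + 1) → MvLinPoly F s} (hJ : (discrepancySet q a g).Nonempty) :
    ∃ j₀, MvLinPoly.eval q (g j₀) a ≠ 0 ∧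
      (∀ j, MvLinPoly.eval q (g j) a ≠ 0 → leadingRank k (g j₀) ≤ leadingRank k (g j)) ∧
      ∀ j, interpolationStep q k a g j =
        if j = j₀ then
          MvLinPoly.eval q (g j₀) a • MvLinPoly.shift q (g j₀)
            - MvLinPoly.eval q (MvLinPoly.shift q (g j₀)) a • g j₀
        else if j ∈ discrepancySet q a g then
          MvLinPoly.eval q (g j₀) a • g j - MvLinPoly.eval q (g j) a • g j₀
        else g j := by
  refine ⟨Function.argminOn (fun j => leadingRank k (g j)) (discrepancySet q a g) hJ,
    Function.argminOn_mem (fun j => leadingRank k (g j)) _ hJ,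
    fun j hj => Function.argminOn_le (fun j => leadingRank k (g j)) (discrepancySet q a g) hj,
    fun j => ?_⟩
  unfold interpolationStep
  rw [dif_pos hJ]

/-- Away from the pivot, minimality is inherited because the module shrinks; only the pivot, whose
exponent grows by one, needs the reduction argument. -/
lemma IsMinimalFamily.step {k m : ℕ} (hm : m < n) (hq : q ≠ 0) (φ : F →+* F)
    (hφ : ∀ a, φ a = a ^ q) {g : Fin (s + 1) → MvLinPoly F s} {e : Fin (s + 1) → ℕ}
    (hg : IsMinimalFamily k (vanishing q P m) g e) :
    ∃ e', IsMinimalFamily k (vanishing q P (m + 1)) (interpolationStep q k (P ⟨m, hm⟩) g) e' := by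
  classical
  set a := P ⟨m, hm⟩ with ha
  by_cases hJ : (discrepancySet q a g).Nonempty
  · obtain ⟨j₀, hmem, hmin₀, hstep⟩ := interpolationStep_of_nonempty k hJ
    have hmin : ∀ j, MvLinPoly.eval q (g j) a ≠ 0 →
        monomialRank k j₀ (e j₀) ≤ monomialRank k j (e j) := by
      intro j hj
      have := hmin₀ j hj
      rw [(hg.isLeading _).leadingRank_eq, (hg.isLeading _).leadingRank_eq] at this
      exact WithBot.coe_le_coe.1 this
    -- Strict, since different leading variables exclude ties; subtracting the pivot thus keeps the
    -- leading term.
    have hmin' : ∀ j, j ≠ j₀ → MvLinPoly.eval q (g j) a ≠ 0 →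
        monomialRank k j₀ (e j₀) < monomialRank k j (e j) := fun j hne hj =>
      lt_of_le_of_ne (hmin j hj) fun h => hne (monomialRank_injective h).1.symm
    refine ⟨Function.update e j₀ (e j₀ + 1), ?_, ?_, ?_⟩
    · intro j
      rw [hstep, vanishing_succ hm, ← ha]
      split_ifs with h1 h2
      · refine ⟨sub_smul_mem_vanishing (fun l hl => ?_) (hg.mem j₀) _ _, ?_⟩
        · exact eval_shift_eq_zero hq φ hφ (hg.mem j₀ l hl)
        · rw [MvLinPoly.eval_sub_smul, mul_comm, sub_self]
      · refine ⟨sub_smul_mem_vanishing (hg.mem j) (hg.mem j₀) _ _, ?_⟩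
        rw [MvLinPoly.eval_sub_smul, mul_comm, sub_self]
      · exact ⟨hg.mem j, not_not.1 h2⟩
    · intro j
      rw [hstep]
      split_ifs with h1 h2
      · subst h1
        rw [Function.update_self]
        refine ((hg.isLeading j).shift hq).sub_smul (hg.isLeading j) ?_ hmem _
        rw [monomialRank_lt_iff]
        left; omega
      · rw [Function.update_of_ne h1]
        exact (hg.isLeading j).sub_smul (hg.isLeading j₀) (hmin' j h1 h2) hmem _
      · rw [Function.update_of_ne h1]
        exact hg.isLeading j
    · intro Q hQ j i hji
      obtain ⟨hQm, hQa⟩ := (vanishing_succ hm).1 hQ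
      have hle := hg.minimal Q hQm j i hji
      by_cases h1 : j = j₀
      · subst h1
        rw [Function.update_self]
        refine Nat.succ_le_of_lt (lt_of_le_of_ne hle ?_)
        rintro rfl
        -- If the exponent did not grow, this difference would vanish at `a`; but `Q` vanishes there
        -- and the pivot does not.
        have hred := hg.eval_eq_zero hq φ hφ a (monomialRank k j (e j))
          (fun j' hj' => by
            by_contra hne
            exact absurd (hmin j' hne) (not_le.2 hj'))
          (g j j (e j) • Q - Q j (e j) • g j)
          (sub_smul_mem_vanishing hQm (hg.mem j) _ _)
          (fun _ _ h => hji.lt_of_cancel (hg.isLeading j) h)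
        rw [MvLinPoly.eval_sub_smul, hQa, mul_zero, zero_sub, neg_eq_zero] at hred
        exact mul_ne_zero hji.ne_zero hmem hred
      · rwa [Function.update_of_ne h1]
  · refine ⟨e, ?_, ?_, fun Q hQ => hg.minimal Q ((vanishing_succ hm).1 hQ).1⟩
    · intro j
      rw [interpolationStep, dif_neg hJ, vanishing_succ hm]
      refine ⟨hg.mem j, ?_⟩
      by_contra hne
      exact hJ ⟨j, hne⟩
    · rw [interpolationStep, dif_neg hJ]
      exact hg.isLeading

lemma isMinimalFamily_interpolationRun {k : ℕ} (hq : q ≠ 0) (φ : F →+* F)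
    (hφ : ∀ a, φ a = a ^ q) (x : Fin n → F) (r : Fin s → Fin n → F) {m : ℕ} (hm : m ≤ n) :
    ∃ e, IsMinimalFamily k (vanishing q (point x r) m) (interpolationRun q k x r m) e := by
  classical
  induction m with
  | zero =>
    refine ⟨0, fun j l hl => absurd hl (Nat.not_lt_zero _), fun j => ⟨?_, fun j' i' h => ?_⟩,
      fun _ _ _ _ _ => Nat.zero_le _⟩
    · simp [interpolationRun]
    · simp only [interpolationRun] at h
      rcases eq_or_ne j' j with rfl | hne
      · rcases eq_or_ne i' 0 with rfl | hi
        · exact le_rfl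
        · simp [hi.symm] at h
      · simp [hne] at h
  | succ m ih =>
    obtain ⟨e, he⟩ := ih (by omega)
    rw [interpolationRun, dif_pos (by omega : m < n)]
    exact he.step (by omega) hq φ hφ

end Algorithm

/-! ### Kernel vectors of the interpolation matrix as polynomials -/

section LinearSystem

variable {n q τ k : ℕ}

/-- The polynomial with a given vector of coefficients. -/
noncomputable def ofCoeffs (u : CoeffIndex n s τ k → F) : MvLinPoly F s :=
  Fin.cons (∑ e : Fin (n - τ), Finsupp.single (e : ℕ) (u (Sum.inl e)))
    fun j => ∑ e : Fin (n - τ - k + 1), Finsupp.single (e : ℕ) (u (Sum.inr (j, e)))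

lemma sum_single_apply_ne_zero {N i : ℕ} {c : Fin N → F}
    (h : (∑ e : Fin N, Finsupp.single (e : ℕ) (c e)) i ≠ 0) : ∃ hi : i < N, c ⟨i, hi⟩ ≠ 0 := by
  rw [Finsupp.finsetSum_apply] at h
  obtain ⟨e, _, he⟩ := Finset.exists_ne_zero_of_sum_ne_zero h
  obtain rfl : (e : ℕ) = i := by
    by_contra hne
    exact he (Finsupp.single_eq_of_ne (Ne.symm hne))
  exact ⟨e.2, by simpa using he⟩

lemma sum_single_apply {N : ℕ} (c : Fin N → F) (i : Fin N) :
    (∑ e : Fin N, Finsupp.single (e : ℕ) (c e)) (i : ℕ) = c i := by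
  rw [Finsupp.finsetSum_apply, Finset.sum_eq_single i]
  · simp
  · intro e _ hne
    exact Finsupp.single_eq_of_ne fun h => hne (Fin.ext h.symm)
  · simp

lemma LinPoly.eval_sum_single {N : ℕ} (c : Fin N → F) (a : F) :
    LinPoly.eval q (∑ e : Fin N, Finsupp.single (e : ℕ) (c e)) a =
      ∑ e : Fin N, c e * a ^ q ^ (e : ℕ) := by
  unfold LinPoly.eval
  rw [← Finsupp.sum_finsetSum_index (fun _ => zero_mul _) (fun _ _ _ => add_mul _ _ _)]
  exact Finset.sum_congr rfl fun e _ => Finsupp.sum_single_index (zero_mul _)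

lemma eval_ofCoeffs (x : Fin n → F) (r : Fin s → Fin n → F) (u : CoeffIndex n s τ k → F)
    (i : Fin n) : MvLinPoly.eval q (ofCoeffs u) (point x r i) =
      (interpolationMatrix q τ k x r).mulVec u i := by
  simp only [MvLinPoly.eval, ofCoeffs, point, Fin.sum_univ_succ (n := s), Fin.cons_zero, Fin.cons_succ,
    LinPoly.eval_sum_single, Matrix.mulVec, dotProduct, interpolationMatrix, Matrix.of_apply,
    Fintype.sum_sum_type, Fintype.sum_prod_type, Sum.elim_inl, Sum.elim_inr, mul_comm]

/-- The powers of `x` reach at most weighted degree `n-τ-1 = (k-1) + (n-τ-k)`, and a tie is lost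
because `x` precedes `y_j`. Among the other variables, only `y_j` keeps a top coefficient. -/
lemma isLeading_ofCoeffs (hk : 1 ≤ k) (hτ : τ + k ≤ n) {u : CoeffIndex n s τ k → F} {j : Fin s}
    (hu : ∀ j', u (Sum.inr (j', Fin.last (n - τ - k))) = (Pi.single j 1 : Fin s → F) j') :
    IsLeading k (ofCoeffs u) j.succ (n - τ - k) where
  ne_zero := by
    have h := sum_single_apply (fun e => u (Sum.inr (j, e))) (Fin.last (n - τ - k))
    rw [hu, Pi.single_eq_same] at h
    rw [ofCoeffs, Fin.cons_succ]
    exact h.trans_ne one_ne_zero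
  le := by
    intro j' i' h
    have hw : weight k j.succ = k - 1 := if_neg (Fin.succ_ne_zero j)
    rw [monomialRank_le_iff, hw]
    induction j' using Fin.cases with
    | zero =>
      obtain ⟨hi, -⟩ := sum_single_apply_ne_zero (c := fun e => u (Sum.inl e)) h
      have hw0 : weight k (0 : Fin (s + 1)) = 0 := if_pos rfl
      have : (0 : Fin (s + 1)) ≤ j.succ := Fin.zero_le _
      rw [hw0]
      omega
    | succ j' =>
      obtain ⟨hi, hne⟩ := sum_single_apply_ne_zero (c := fun e => u (Sum.inr (j', e))) h
      have hw' : weight k j'.succ = k - 1 := if_neg (Fin.succ_ne_zero j')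
      rw [hw']
      rcases Nat.lt_succ_iff_lt_or_eq.1 hi with hi' | rfl
      · left; omega
      · obtain rfl : j' = j := by
          by_contra hjj
          exact hne ((hu j').trans (Pi.single_eq_of_ne hjj _))
        exact .inr ⟨rfl, le_rfl⟩

lemma exists_solution_of_rank_eq {x : Fin n → F} {r : Fin s → Fin n → F} {d : ℕ}
    (b : Fin d → solutionSpace q τ k x r)
    (hrank : (leadingCoeffMatrix fun h => (b h : CoeffIndex n s τ k → F)).rank = s)
    (j : Fin s) : ∃ u ∈ solutionSpace q τ k x r,
      ∀ j', u (Sum.inr (j', Fin.last (n - τ - k))) = (Pi.single j 1 : Fin s → F) j' := by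
  set M := leadingCoeffMatrix fun h => (b h : CoeffIndex n s τ k → F) with hM
  -- Rank `s` makes the transpose surjective, so the rows of `M` combine to any prescribed top
  -- coefficients.
  have htop : LinearMap.range M.transpose.mulVecLin = ⊤ := by
    apply Submodule.eq_top_of_finrank_eq
    rw [← Matrix.rank, Matrix.rank_transpose, hrank, Module.finrank_fin_fun]
  obtain ⟨w, hw⟩ := LinearMap.range_eq_top.1 htop (Pi.single j 1)
  refine ⟨∑ h, w h • b h, ?_, fun j' => ?_⟩
  · exact Submodule.sum_mem _ fun h _ => Submodule.smul_mem _ _ (b h).2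
  · rw [← hw]
    simp [hM, leadingCoeffMatrix, Matrix.vecMul, dotProduct]

end LinearSystem

end LinInterp

theorem mainTheorem2 {Fq Fqm : Type*} [Field Fq] [Fintype Fq] [Field Fqm] [Fintype Fqm]
    [Algebra Fq Fqm] (n s k τ : ℕ) (hk : 1 ≤ k) (hτ : τ + k ≤ n)
    (x : Fin n → Fqm) (r : Fin s → Fin n → Fqm)
    (b : Module.Basis
      (Fin (Module.finrank Fqm (LinInterp.solutionSpace (Fintype.card Fq) τ k x r)))
      Fqm (LinInterp.solutionSpace (Fintype.card Fq) τ k x r))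
    (hrank : (LinInterp.leadingCoeffMatrix (fun h => (b h : LinInterp.CoeffIndex n s τ k → Fqm))).rank
      = s) :
    LinearIndependent Fqm (LinInterp.interpolateBasis (Fintype.card Fq) k x r) ∧
    (∀ j, LinInterp.weightedDegree k (LinInterp.interpolateBasis (Fintype.card Fq) k x r j)
      < ((n - τ : ℕ) : WithBot ℕ)) ∧
    LinInterp.SolvesExtendedInterpolation (Fintype.card Fq) τ k x r
      (LinInterp.interpolateBasis (Fintype.card Fq) k x r) := by
  classical
  obtain ⟨φ, hφ⟩ : ∃ φ : Fqm →+* Fqm, ∀ a, φ a = a ^ Fintype.card Fq :=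
    ⟨(FiniteField.frobeniusAlgHom Fq Fqm).toRingHom, fun _ => rfl⟩
  obtain ⟨e, he⟩ := LinInterp.isMinimalFamily_interpolationRun (k := k) Fintype.card_ne_zero φ hφ
    x r le_rfl
  have hind : LinearIndependent Fqm (LinInterp.interpolateBasis (Fintype.card Fq) k x r) :=
    (LinInterp.linearIndependent_of_isLeading fun j => ⟨e j, he.isLeading j⟩).comp _
      (Fin.succ_injective s)
  have hcoeff : ∀ j j' i, LinInterp.interpolateBasis (Fintype.card Fq) k x r j j' i ≠ 0 →
      LinInterp.weight k j' + i < n - τ := by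
    intro j j' i hne
    obtain ⟨u, hu, hu'⟩ := LinInterp.exists_solution_of_rank_eq b hrank j
    have hmem : LinInterp.ofCoeffs u ∈
        LinInterp.vanishing (Fintype.card Fq) (LinInterp.point x r) n := fun l _ => by
      rw [LinInterp.eval_ofCoeffs]
      exact congrFun (LinearMap.mem_ker.1 hu) l
    have hle := he.minimal _ hmem _ _ (LinInterp.isLeading_ofCoeffs hk hτ hu')
    have hlead := (he.isLeading j.succ).le j' i hne
    have hw : LinInterp.weight k j.succ = k - 1 := if_neg (Fin.succ_ne_zero j)
    rw [LinInterp.monomialRank_le_iff, hw] at hlead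
    -- The leading weighted degree is at most `(k-1) + (n-τ-k) = n-τ-1`, and it bounds that of every
    -- monomial.
    omega
  refine ⟨hind, fun j => LinInterp.weightedDegree_lt_iff.2 (hcoeff j), le_rfl, hind, fun j => ?_⟩
  refine ⟨hind.ne_zero j, fun i => he.mem j.succ i i.2, ?_, fun j' => ?_⟩
  · refine LinInterp.qDegree_lt_iff.2 fun i hi => ?_
    have := hcoeff j 0 i hi
    omega
  · refine LinInterp.qDegree_lt_iff.2 fun i hi => ?_
    have := hcoeff j j'.succ i hi
    rw [show LinInterp.weight k j'.succ = k - 1 from if_neg (Fin.succ_ne_zero j')] at this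
    omega
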